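/- Write $x\subseteq^* y$ if $x\setminus y$ is finite. A tower (of cardinality $\kappa$) is a set $T$ of infinite subsets of $\mathbb{N}$ that can be enumerated bijectively as $\{x_\alpha:\alpha<\kappa\}$, for a cardinal $\kappa$, so that $x_\beta\subseteq^* x_\alpha$ for all $\alpha<\beta<\kappa$. A set $T$ of infinite subsets of $\mathbb{N}$ is unbounded if for every $g:\mathbb{N}\to\mathbb{N}$ there is $x\in T$ such that, for infinitely many $n$, $g(n)$ is less than the $n$-th element of $x$ in increasing order. A countably infinite subset $A$ of a topological space $Y$ converges to $y\in Y$ if each bijective enumeration of $A$ by $\mathbb{N}$ converges to $y$. The space $Y$ is an $\alpha_1$ space if for each $y\in Y$ and all countably infinite sets $A_0,A_1,\dots\subseteq Y$, each converging to $y$, there are cofinite subsets $B_n\subseteq A_n$ ($n\in\mathbb{N}$) such that the countably infinite set $\bigcup_n B_n$ converges to $y$. It is an $\alpha_2$ space if the same holds with singletons $B_n\subseteq A_n$ in place of cofinite subsets, where $\bigcup_n B_n$ is again required to be (countably) infinite and to converge to $y$. For $X\subseteq\mathbb{R}$, let $C(X)$ be the set of all continuous functions $f:X\to\mathbb{R}$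 with the topology of pointwise convergence, i.e. as a subspace of the product $\mathbb{R}^X$. **Theorem.** If there is an unbounded tower (of any cardinality), then there is a set $X\subseteq\mathbb{R}$ such that $C(X)$ is an $\alpha_2$ space but not an $\alpha_1$ space. -/

import Mathlib

namespace UnboundedTower

/-- `x ⊆* y`: all but finitely many elements of `x` belong to `y`. -/
def AlmostSubset (x y : Set ℕ) : Prop := (x \ y).Finite

/-- `T` is a tower of cardinality `κ`: a set of infinite subsets of `ℕ` that can be enumerated
bijectively by the ordinals `α < κ` in such a way that `x β ⊆* x α` for all `α < β < κ`. -/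
def IsTower (κ : Cardinal.{0}) (T : Set (Set ℕ)) : Prop :=
  (∀ s ∈ T, s.Infinite) ∧
    ∃ x : Ordinal.{0} → Set ℕ, Set.BijOn x (Set.Iio κ.ord) T ∧
      ∀ α β : Ordinal.{0}, α < β → β < κ.ord → AlmostSubset (x β) (x α)

/-- A set `T` of infinite subsets of `ℕ` is unbounded if for every `g : ℕ → ℕ` there is `x ∈ T`
such that `g n` is less than the `n`-th element of `x` for infinitely many `n`. -/
def IsUnbounded (T : Set (Set ℕ)) : Prop :=
  (∀ s ∈ T, s.Infinite) ∧
    ∀ g : ℕ → ℕ, ∃ x ∈ T, {n : ℕ | g n < Nat.nth (fun k => k ∈ x) n}.Infinite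

/-- `A` is a countably infinite set that converges to `y`: each bijective enumeration of `A` by
the natural numbers converges to `y`. -/
def SetConvergesTo {Y : Type*} [TopologicalSpace Y] (A : Set Y) (y : Y) : Prop :=
  A.Countable ∧ A.Infinite ∧
    ∀ e : ℕ ≃ A, Filter.Tendsto (fun n => (e n : Y)) Filter.atTop (nhds y)

/-- `Y` is an `α₁` space. -/
def IsAlphaOne (Y : Type*) [TopologicalSpace Y] : Prop :=
  ∀ (y : Y) (A : ℕ → Set Y), (∀ n, SetConvergesTo (A n) y) →
    ∃ B : ℕ → Set Y, (∀ n, B n ⊆ A n ∧ (A n \ B n).Finite) ∧ SetConvergesTo (⋃ n, B n) y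

/-- `Y` is an `α₂` space. -/
def IsAlphaTwo (Y : Type*) [TopologicalSpace Y] : Prop :=
  ∀ (y : Y) (A : ℕ → Set Y), (∀ n, SetConvergesTo (A n) y) →
    ∃ B : ℕ → Set Y, (∀ n, B n ⊆ A n ∧ ∃ b, B n = {b}) ∧ SetConvergesTo (⋃ n, B n) y

/-- `C(X)`, the continuous real-valued functions on `X`, as a subspace of the Tychonoff product
`ℝ ^ X` (the topology of pointwise convergence). -/
abbrev PointwiseC (X : Set ℝ) : Type := {f : X → ℝ // Continuous f}

end UnboundedTower

/-!
The set `X` is a copy, inside the Cantor set, of the family consisting of all finite sets of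
natural numbers and all members of an unbounded tower `x` whose length is the bounding number `𝔟`,
so that families of functions indexed by proper initial segments of `x` are always bounded.

*Such a tower exists* (`exists_short_unbounded_tower`). Take a scale `F i`, `i < 𝔟`: an unbounded
family of monotone functions, increasing modulo finite sets. If some `h` is dominated by no `F i`,
the sets `{n | F i n < h n}` form an unbounded tower. Otherwise the scale is dominating, and
attaching to each `i` the first member of the given tower whose enumeration is not dominated by
`F i` produces one.

*The `α₂` property* (`exists_selection`, `isAlphaTwo_of_selection`). By translating convergence
into open sets, one is given for each `n` a sequence of open sets that eventually contains each
point. As the finite sets belong to the space, there are consecutive intervals such that every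
point missing the `k`-th interval lies in a prescribed late term of each of the first `k`
sequences (`exists_gap`). By unboundedness some `x i` misses infinitely many of the intervals, and
then each finite set and each `x j` with `j ≥ i` misses almost all of those. The points `x j` with
`j < i` are taken care of by a bound for the fewer than `𝔟` functions saying how late one has to
choose.

*Failure of `α₁`* (`not_isAlphaOne_of_unbounded`). The indicator functions of
"`m` is the `n`-th element of the set" are continuous and, for each fixed `n`, converge to `0` as
`m` grows. A choice of cofinite subsets whose union converges to `0` would bound the
enumerations of all members of the tower.
-/

namespace UnboundedTower

open Filter Topology Set
open scoped Cardinal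

/-! ### Bounded families of functions and a short unbounded tower -/

/-- A family of functions `ℕ → ℕ` is eventually bounded if a single function dominates each
member of the family at all but finitely many arguments. -/
def EventuallyBounded {ι : Type*} (H : ι → ℕ → ℕ) : Prop :=
  ∃ g : ℕ → ℕ, ∀ i, H i ≤ᶠ[atTop] g

theorem exists_monotone_ge (f : ℕ → ℕ) : ∃ g : ℕ → ℕ, Monotone g ∧ f ≤ g :=
  ⟨partialSups f, (partialSups f).monotone, le_partialSups f⟩

/-- The order type of `ι` is the least cardinality of an unbounded family, so fewer functions are
always bounded. -/
theorem exists_minimal_unbounded_family :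
    ∃ (ι : Type) (_ : LinearOrder ι) (_ : WellFoundedLT ι) (H : ι → ℕ → ℕ),
      (∀ (i : ι) (K : Iio i → ℕ → ℕ), EventuallyBounded K) ∧ ¬ EventuallyBounded H := by
  let S : Set Cardinal.{0} :=
    {c | ∃ (α : Type) (H : α → ℕ → ℕ), #α = c ∧ ¬ EventuallyBounded H}
  have hS : S.Nonempty := by
    refine ⟨_, ℕ → ℕ, id, rfl, ?_⟩
    rintro ⟨g, hg⟩
    obtain ⟨n, hn⟩ := (hg (fun n => g n + 1)).exists
    simp at hn
  obtain ⟨α, H, hα, hH⟩ := csInf_mem hS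
  have hcard : #(sInf S).ord.ToType = #α := by rw [hα, Cardinal.mk_ord_toType]
  obtain ⟨e⟩ := Cardinal.eq.1 hcard
  refine ⟨(sInf S).ord.ToType, inferInstance, inferInstance, fun i => H (e i), ?_, ?_⟩
  · intro i K
    by_contra hK
    exact (Cardinal.mk_Iio_lt i (by simp)).not_ge
      ((Cardinal.mk_ord_toType _).le.trans (csInf_le' ⟨_, K, rfl, hK⟩))
  · rintro ⟨g, hg⟩
    exact hH ⟨g, fun a => by simpa using hg (e.symm a)⟩

/-- A `𝔟`-scale: an unbounded family of monotone functions that is increasing modulo finite sets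
along a well-order all of whose proper initial segments only carry bounded families. -/
theorem exists_unbounded_scale :
    ∃ (ι : Type) (_ : LinearOrder ι) (_ : WellFoundedLT ι) (F : ι → ℕ → ℕ),
      (∀ (i : ι) (K : Iio i → ℕ → ℕ), EventuallyBounded K) ∧ (∀ i, Monotone (F i)) ∧
        (∀ i j, i < j → F i ≤ᶠ[atTop] F j) ∧ ¬ EventuallyBounded F := by
  obtain ⟨ι, _, _, H, hK, hH⟩ := exists_minimal_unbounded_family
  have step : ∀ (i : ι) (K : ∀ j, j < i → ℕ → ℕ),
      ∃ g : ℕ → ℕ, Monotone g ∧ H i ≤ g ∧ ∀ j hj, K j hj ≤ᶠ[atTop] g := by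
    intro i K
    obtain ⟨g, hg⟩ := hK i (fun j => K j.1 j.2)
    obtain ⟨g', hmono, hg'⟩ := exists_monotone_ge (g ⊔ H i)
    refine ⟨g', hmono, le_sup_right.trans hg', fun j hj => ?_⟩
    exact (hg ⟨j, hj⟩).mono fun n hn => hn.trans ((le_sup_left.trans hg' : g ≤ g') n)
  choose G hmono hGH hGK using step
  let F : ι → ℕ → ℕ := wellFounded_lt.fix G
  have hF : ∀ i, F i = G i (fun j _ => F j) := fun i => wellFounded_lt.fix_eq G i
  refine ⟨ι, _, inferInstance, F, hK, fun i => ?_, fun i j hij => ?_, ?_⟩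
  · rw [hF]; exact hmono _ _
  · rw [hF j]; exact hGK j (fun j _ => F j) i hij
  · rintro ⟨g, hg⟩
    refine hH ⟨g, fun i => (hg i).mono fun n hn => le_trans ?_ hn⟩
    rw [hF]; exact hGH _ _ n

theorem AlmostSubset.refl (x : Set ℕ) : AlmostSubset x x := by
  simp [AlmostSubset]

/-- The increasing enumeration of a set of natural numbers (meaningful for infinite sets). -/
noncomputable def enum (x : Set ℕ) (n : ℕ) : ℕ := Nat.nth (fun k => k ∈ x) n

theorem enum_mem {x : Set ℕ} (hx : x.Infinite) (n : ℕ) : enum x n ∈ x :=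
  Nat.nth_mem_of_infinite hx n

theorem enum_strictMono {x : Set ℕ} (hx : x.Infinite) : StrictMono (enum x) :=
  Nat.nth_strictMono hx

theorem not_eventually_le_iff {f g : ℕ → ℕ} :
    ¬ f ≤ᶠ[atTop] g ↔ {n | g n < f n}.Infinite := by
  rw [← Nat.frequently_atTop_iff_infinite, EventuallyLE, not_eventually]
  simp only [not_le]

/-- An unbounded tower of arbitrary length yields one along a well-order all of whose proper
initial segments only carry bounded families. -/
theorem exists_short_unbounded_tower {κ : Cardinal.{0}} {T : Set (Set ℕ)} (hT : IsTower κ T)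
    (hU : IsUnbounded T) :
    ∃ (ι : Type) (_ : LinearOrder ι) (x : ι → Set ℕ),
      (∀ (i : ι) (K : Iio i → ℕ → ℕ), EventuallyBounded K) ∧ (∀ i, (x i).Infinite) ∧
        (∀ i j, i ≤ j → AlmostSubset (x j) (x i)) ∧
          ¬ EventuallyBounded (fun i => enum (x i)) := by
  obtain ⟨ι, _, _, F, hK, hFmono, hFlt, hF⟩ := exists_unbounded_scale
  by_cases hdom : ∃ h : ℕ → ℕ, ∀ i, ¬ h ≤ᶠ[atTop] F i
  · -- If no member of the scale dominates `h`, the sets where it is below `h` form a tower.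
    obtain ⟨h, hh⟩ := hdom
    obtain ⟨h', hmono, hle⟩ := exists_monotone_ge h
    have hinf : ∀ i, {n | F i n < h' n}.Infinite := fun i =>
      (not_eventually_le_iff.1 (hh i)).mono fun n hn => lt_of_lt_of_le hn (hle n)
    refine ⟨ι, _, fun i => {n | F i n < h' n}, hK, hinf, fun i j hij => ?_, ?_⟩
    · rcases hij.eq_or_lt with rfl | hij
      · exact AlmostSubset.refl _
      · have := hFlt i j hij
        rw [EventuallyLE, ← Nat.cofinite_eq_atTop, eventually_cofinite] at this
        refine this.subset fun n hn hn' => hn.2 (lt_of_le_of_lt hn' hn.1)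
    · rintro ⟨g, hg⟩
      refine hF ⟨h' ∘ g, fun i => (hg i).mono fun n hn => ?_⟩
      calc F i n ≤ F i (enum {n | F i n < h' n} n) :=
            hFmono i ((enum_strictMono (hinf i)).le_apply)
        _ ≤ h' (enum {n | F i n < h' n} n) := (enum_mem (hinf i) n).le
        _ ≤ h' (g n) := hmono hn
  · -- Otherwise the scale is dominating, and the first member of the given tower that escapes the
    -- bound `F i` depends monotonically on `i`.
    push Not at hdom
    obtain ⟨-, x, hbij, hx⟩ := hT
    have hex : ∀ i, {ξ : Ordinal.{0} | ξ < κ.ord ∧ ¬ enum (x ξ) ≤ᶠ[atTop] F i}.Nonempty := by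
      intro i
      obtain ⟨s, hs, hsi⟩ := hU.2 (F i)
      obtain ⟨ξ, hξ, rfl⟩ := hbij.surjOn hs
      exact ⟨ξ, hξ, not_eventually_le_iff.2 hsi⟩
    let ξ : ι → Ordinal.{0} :=
      fun i => sInf {ξ : Ordinal.{0} | ξ < κ.ord ∧ ¬ enum (x ξ) ≤ᶠ[atTop] F i}
    have hξ : ∀ i, ξ i < κ.ord ∧ ¬ enum (x (ξ i)) ≤ᶠ[atTop] F i := fun i => csInf_mem (hex i)
    have hmono : Monotone ξ := by
      intro i j hij
      rcases hij.eq_or_lt with rfl | hij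
      · exact le_rfl
      · exact csInf_le' ⟨(hξ j).1, fun hi => (hξ j).2 (hi.trans (hFlt i j hij))⟩
    refine ⟨ι, _, fun i => x (ξ i), hK, fun i => hU.1 _ (hbij.mapsTo (hξ i).1),
      fun i j hij => ?_, ?_⟩
    · rcases (hmono hij).eq_or_lt with he | hlt
      · simp only [he]; exact AlmostSubset.refl _
      · exact hx _ _ hlt (hξ j).1
    · rintro ⟨g, hg⟩
      obtain ⟨i, hi⟩ := hdom g
      exact (hξ i).2 ((hg i).trans hi)

/-- A set that is not bounded by `n ↦ a (2 * n)` misses infinitely many of the intervals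
`[a k, a (k + 1))`, since it gains an element from each interval that it meets. -/
theorem infinite_setOf_disjoint_Ico {x : Set ℕ} (hx : x.Infinite) {a : ℕ → ℕ} (ha : StrictMono a)
    (h : ¬ enum x ≤ᶠ[atTop] fun n => a (2 * n)) :
    {k | Disjoint x (Ico (a k) (a (k + 1)))}.Infinite := by
  intro hfin
  obtain ⟨K, hK⟩ := hfin.bddAbove
  have hmeet : ∀ k, K < k → ∃ m ∈ x, a k ≤ m ∧ m < a (k + 1) := by
    intro k hk
    by_contra hcon
    refine hk.not_ge (hK (disjoint_left.2 fun m hm hm' => hcon ⟨m, hm, hm'.1, hm'.2⟩))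
  have key : ∀ n, enum x n < a (K + 1 + n + 1) := by
    intro n
    induction n with
    | zero =>
      obtain ⟨m, hm, -, hm'⟩ := hmeet (K + 1) (by omega)
      exact lt_of_le_of_lt (Nat.isLeast_nth_of_infinite (p := (· ∈ x)) hx 0 |>.2
        ⟨hm, fun k hk => absurd hk (by omega)⟩) hm'
    | succ n ih =>
      obtain ⟨m, hm, h1, hm'⟩ := hmeet (K + 1 + (n + 1)) (by omega)
      refine lt_of_le_of_lt (Nat.isLeast_nth_of_infinite (p := (· ∈ x)) hx (n + 1) |>.2
        ⟨hm, fun k hk => lt_of_le_of_lt ((enum_strictMono hx).monotone (Nat.lt_succ_iff.1 hk))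
          (lt_of_lt_of_le ih h1)⟩) hm'
  refine h ?_
  filter_upwards [eventually_ge_atTop (K + 2)] with n hn
  exact (key n).le.trans (ha.monotone (by omega))

/-! ### Convergence of countable sets -/

/-- Convergence of a countably infinite set does not refer to enumerations: every neighbourhood
of the limit contains all but finitely many of its points. -/
theorem setConvergesTo_iff {Y : Type*} [TopologicalSpace Y] {A : Set Y} {y : Y} :
    SetConvergesTo A y ↔ A.Countable ∧ A.Infinite ∧ ∀ U ∈ 𝓝 y, (A \ U).Finite := by
  refine and_congr_right fun hc => and_congr_right fun hi => ⟨fun h U hU => ?_, fun h e => ?_⟩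
  · have := hc.to_subtype
    have := hi.to_subtype
    obtain ⟨e⟩ := nonempty_equiv_of_countable (α := ℕ) (β := A)
    have h1 := h e hU
    rw [mem_map, ← Nat.cofinite_eq_atTop, mem_cofinite] at h1
    refine (h1.image fun n => (e n : Y)).subset ?_
    rintro a ⟨ha, haU⟩
    exact ⟨e.symm ⟨a, ha⟩, by simpa using haU, by simp⟩
  · intro U hU
    rw [mem_map, ← Nat.cofinite_eq_atTop, mem_cofinite]
    refine Finite.of_finite_image ((h U hU).subset ?_)
      (f := fun n => (e n : Y)) (Subtype.val_injective.comp e.injective).injOn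
    rintro _ ⟨n, hn, rfl⟩
    exact ⟨(e n).2, hn⟩

theorem setConvergesTo_range {Y : Type*} [TopologicalSpace Y] {y : Y} {f : ℕ → Y}
    (hinf : (range f).Infinite) (hf : Tendsto f atTop (𝓝 y)) : SetConvergesTo (range f) y := by
  refine setConvergesTo_iff.2 ⟨countable_range f, hinf, fun U hU => ?_⟩
  have h := hf hU
  rw [mem_map, ← Nat.cofinite_eq_atTop, mem_cofinite] at h
  refine (h.image f).subset ?_
  rintro _ ⟨⟨n, rfl⟩, hn⟩
  exact ⟨n, hn, rfl⟩

theorem infinite_range_of_tendsto {Y : Type*} [TopologicalSpace Y] [T1Space Y] {y : Y} {f : ℕ → Y}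
    (hne : ∀ n, f n ≠ y) (hf : Tendsto f atTop (𝓝 y)) : (range f).Infinite := by
  intro hfin
  have hy : y ∉ range f := by rintro ⟨n, hn⟩; exact hne n hn
  obtain ⟨n, hn⟩ := (hf.eventually (hfin.isClosed.isOpen_compl.mem_nhds hy)).exists
  exact hn ⟨n, rfl⟩

/-- The sequence may be taken to avoid the limit, which makes the range of every convergent
selection from such sequences infinite (`infinite_range_of_tendsto`). -/
theorem SetConvergesTo.exists_seq {Y : Type*} [TopologicalSpace Y] {A : Set Y} {y : Y}
    (hA : SetConvergesTo A y) :
    ∃ f : ℕ → Y, (∀ n, f n ∈ A ∧ f n ≠ y) ∧ Tendsto f atTop (𝓝 y) := by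
  obtain ⟨hc, hi, h⟩ := setConvergesTo_iff.1 hA
  have := (hc.mono sdiff_subset : (A \ {y}).Countable).to_subtype
  have := (hi.sdiff (finite_singleton y)).to_subtype
  obtain ⟨e⟩ := nonempty_equiv_of_countable (α := ℕ) (β := ↥(A \ {y}))
  refine ⟨fun n => e n, fun n => ⟨(e n).2.1, (e n).2.2⟩, fun U hU => ?_⟩
  rw [mem_map, ← Nat.cofinite_eq_atTop, mem_cofinite]
  refine Finite.of_finite_image ((h U hU).subset ?_)
    (f := fun n => (e n : Y)) (Subtype.val_injective.comp e.injective).injOn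
  rintro _ ⟨n, hn, rfl⟩
  exact ⟨(e n).2.1, hn⟩

/-! ### Spaces of sets of natural numbers -/

/-- `σ` identifies the space `Z` with a family of sets of natural numbers carrying the topology of
the Cantor space: two points are close when their sets agree on a long initial segment of `ℕ`. -/
structure IsSetSpace {Z : Type*} [TopologicalSpace Z] (σ : Z → Set ℕ) : Prop where
  injective : Function.Injective σ
  hasBasis : ∀ z, (𝓝 z).HasBasis (fun _ => True) fun N => {w | ∀ k < N, k ∈ σ w ↔ k ∈ σ z}

theorem IsSetSpace.exists_of_isOpen {Z : Type*} [TopologicalSpace Z] {σ : Z → Set ℕ}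
    (hσ : IsSetSpace σ) {U : Set Z} (hU : IsOpen U) {z : Z} (hz : z ∈ U) :
    ∃ N, ∀ w, (∀ k < N, k ∈ σ w ↔ k ∈ σ z) → w ∈ U := by
  obtain ⟨N, -, hN⟩ := (hσ.hasBasis z).mem_iff.1 (hU.mem_nhds hz)
  exact ⟨N, fun w hw => hN hw⟩

/-- One step of the construction of the intervals: finitely many open sets that contain every
`z` whose set lies below `N` also contain every `z` whose set has a long enough gap after `N`. -/
theorem exists_gap {Z : Type*} [TopologicalSpace Z] {σ : Z → Set ℕ} (hσ : IsSetSpace σ)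
    (hfin : ∀ s : Finset ℕ, ∃ z, σ z = s) {U : ℕ → ℕ → Set Z} (hU : ∀ n m, IsOpen (U n m))
    (hev : ∀ n z, ∀ᶠ m in atTop, z ∈ U n m) (N k : ℕ) :
    ∃ N' > N, ∃ c : ℕ → ℕ, (∀ n, k ≤ c n) ∧
      ∀ n ≤ k, ∀ z, Disjoint (σ z) (Ico N N') → z ∈ U n (c n) := by
  -- `p s` is the point of the finite set `s`; only the `s ⊆ {0, …, N - 1}` matter, since a set with
  -- a gap after `N` agrees with one of them up to the end of the gap.
  choose p hp using hfin
  have h1 : ∀ n, ∃ c ≥ k, ∀ s ∈ (Finset.range N).powerset, p s ∈ U n c := by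
    intro n
    have : ∀ᶠ m in atTop, ∀ s ∈ (Finset.range N).powerset, p s ∈ U n m :=
      (eventually_all_finset _).2 fun s _ => hev n (p s)
    obtain ⟨c, hc⟩ := ((eventually_ge_atTop k).and this).exists
    exact ⟨c, hc.1, hc.2⟩
  choose c hck hc using h1
  have h2 : ∀ n ∈ Finset.range (k + 1), ∀ s ∈ (Finset.range N).powerset,
      ∀ᶠ M in atTop, ∀ w, (∀ l < M, l ∈ σ w ↔ l ∈ σ (p s)) → w ∈ U n (c n) := by
    intro n _ s hs
    obtain ⟨M, hM⟩ := hσ.exists_of_isOpen (hU n (c n)) (hc n s hs)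
    filter_upwards [eventually_ge_atTop M] with M' hM' w hw
    exact hM w fun l hl => hw l (hl.trans_le hM')
  have h3 := (eventually_all_finset _).2 fun n hn => (eventually_all_finset _).2 (h2 n hn)
  obtain ⟨N', hN', hgt⟩ := (h3.and (eventually_gt_atTop N)).exists
  refine ⟨N', hgt, c, hck, fun n hn z hz => ?_⟩
  classical
  refine hN' n (Finset.mem_range.2 (by omega)) ((Finset.range N).filter (· ∈ σ z)) ?_ z ?_
  · exact Finset.mem_powerset.2 (Finset.filter_subset _ _)
  · intro l hl
    rw [hp]
    simp only [Finset.coe_filter, Finset.mem_range, mem_ofPred_eq]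
    refine ⟨fun h => ⟨?_, h⟩, fun h => h.2⟩
    by_contra hlN
    exact disjoint_left.1 hz h ⟨not_lt.1 hlN, hl⟩

/-- The selection principle behind the `α₂` property: the space formed by the finite sets and a
short unbounded tower allows one to select one set from each of countably many
sequences of open sets, each eventually containing every point, so that the selected sequence
again eventually contains every point. -/
theorem exists_selection {Z : Type*} [TopologicalSpace Z] {σ : Z → Set ℕ} (hσ : IsSetSpace σ)
    {ι : Type*} [LinearOrder ι] {x : ι → Set ℕ}
    (hbdd : ∀ (i : ι) (K : Iio i → ℕ → ℕ), EventuallyBounded K) (hinf : ∀ i, (x i).Infinite)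
    (hdec : ∀ i j, i ≤ j → AlmostSubset (x j) (x i))
    (hunb : ¬ EventuallyBounded fun i => enum (x i))
    (hfin : ∀ s : Finset ℕ, ∃ z, σ z = s) (hx : ∀ i, ∃ z, σ z = x i)
    (hrange : ∀ z, (σ z).Finite ∨ ∃ i, σ z = x i)
    {U : ℕ → ℕ → Set Z} (hU : ∀ n m, IsOpen (U n m))
    (hev : ∀ n z, ∀ᶠ m in atTop, z ∈ U n m) :
    ∃ m : ℕ → ℕ, ∀ z, ∀ᶠ n in atTop, z ∈ U n (m n) := by
  choose next hnext c hck hc using exists_gap hσ hfin hU hev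
  let a : ℕ → ℕ := fun k => Nat.rec 0 (fun k N => next N k) k
  have ha : StrictMono a := strictMono_nat_of_lt_succ fun k => hnext (a k) k
  obtain ⟨i, hi⟩ : ∃ i, ¬ enum (x i) ≤ᶠ[atTop] fun n => a (2 * n) := by
    by_contra hcon
    push Not at hcon
    exact hunb ⟨_, hcon⟩
  have hI := infinite_setOf_disjoint_Ico (hinf i) ha hi
  choose p hp using hx
  -- `H j n` is a stage from which on the point of `x j` lies in the `n`-th sequence of sets.
  choose H hH using fun (j : ι) n => eventually_atTop.1 (hev n (p j))
  obtain ⟨g, hg⟩ := hbdd i fun j => H j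
  choose k hkI hk using fun n => hI.exists_gt (max (g n) n)
  refine ⟨fun n => c (a (k n)) (k n) n, fun z => ?_⟩
  by_cases hz : ∃ j < i, σ z = x j
  · obtain ⟨j, hj, hzj⟩ := hz
    obtain rfl : z = p j := hσ.injective (hzj.trans (hp j).symm)
    filter_upwards [hg ⟨j, hj⟩] with n hn
    have h1 := hck (a (k n)) (k n) n
    have h2 := hk n
    exact hH j n _ (hn.trans (by omega))
  · have hzi : AlmostSubset (σ z) (x i) := by
      rcases hrange z with hzf | ⟨j, hj⟩
      · exact hzf.subset sdiff_subset
      · rw [hj]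
        exact hdec i j (not_lt.1 fun hlt => hz ⟨j, hlt, hj⟩)
    obtain ⟨B, hB⟩ := hzi.bddAbove
    filter_upwards [eventually_gt_atTop B] with n hn
    have h2 := hk n
    refine hc (a (k n)) (k n) n (by omega) z (disjoint_left.2 fun l hl hl' => ?_)
    by_cases hlx : l ∈ x i
    · exact disjoint_left.1 (hkI n) hlx hl'
    · have h3 : l ≤ B := hB ⟨hl, hlx⟩
      have h4 : k n ≤ a (k n) := ha.le_apply
      have h5 := hl'.1
      omega

/-! ### The two properties of the function space -/

/-- The selection principle is applied to the sets where the `m`-th function of the `n`-th sequence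
is within `1 / (n + 1)` of the limit. -/
theorem isAlphaTwo_of_selection {Z : Type*} [TopologicalSpace Z]
    (hsel : ∀ U : ℕ → ℕ → Set Z, (∀ n m, IsOpen (U n m)) →
      (∀ n z, ∀ᶠ m in atTop, z ∈ U n m) → ∃ m : ℕ → ℕ, ∀ z, ∀ᶠ n in atTop, z ∈ U n (m n)) :
    IsAlphaTwo {f : Z → ℝ // Continuous f} := by
  intro y A hA
  choose f hf hlim using fun n => (hA n).exists_seq
  have hlim' : ∀ n z, Tendsto (fun m => (f n m).1 z) atTop (𝓝 (y.1 z)) := fun n z =>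
    tendsto_pi_nhds.1 (tendsto_subtype_rng.1 (hlim n)) z
  have hpos : ∀ n : ℕ, (0 : ℝ) < 1 / ((n : ℝ) + 1) := fun n => Nat.one_div_pos_of_nat
  obtain ⟨m, hm⟩ := hsel (fun n m => {z | dist ((f n m).1 z) (y.1 z) < 1 / ((n : ℝ) + 1)})
    (fun n m => isOpen_lt ((f n m).2.dist y.2) continuous_const)
    (fun n z => (Metric.tendsto_nhds.1 (hlim' n z)) _ (hpos n))
  have hconv : Tendsto (fun n => f n (m n)) atTop (𝓝 y) := by
    refine tendsto_subtype_rng.2 (tendsto_pi_nhds.2 fun z => ?_)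
    rw [tendsto_iff_dist_tendsto_zero]
    exact squeeze_zero' (Eventually.of_forall fun n => dist_nonneg)
      ((hm z).mono fun n hn => le_of_lt hn) tendsto_one_div_add_atTop_nhds_zero_nat
  refine ⟨fun n => {f n (m n)}, fun n => ⟨singleton_subset_iff.2 (hf n (m n)).1, _, rfl⟩, ?_⟩
  rw [iUnion_singleton_eq_range]
  exact setConvergesTo_range (infinite_range_of_tendsto (fun n => (hf n (m n)).2) hconv) hconv

open Classical in
/-- The indicator function of the points `z` for which `m` is the `n`-th element of `σ z`. -/
noncomputable def nthIndicator {Z : Type*} (σ : Z → Set ℕ) (n m : ℕ) (z : Z) : ℝ :=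
  if m ∈ σ z ∧ Nat.count (· ∈ σ z) m = n then 1 else 0

theorem nthIndicator_eq_zero {Z : Type*} {σ : Z → Set ℕ} {n m : ℕ} {z : Z} (h : enum (σ z) n ≠ m) :
    nthIndicator σ n m z = 0 := by
  classical
  refine if_neg fun h' => h ?_
  rw [← h'.2]
  exact Nat.nth_count (p := (· ∈ σ z)) h'.1

theorem nthIndicator_enum {Z : Type*} {σ : Z → Set ℕ} {z : Z} (h : (σ z).Infinite) (n : ℕ) :
    nthIndicator σ n (enum (σ z) n) z = 1 := by
  classical
  exact if_pos ⟨enum_mem h n, Nat.count_nth_of_infinite (p := (· ∈ σ z)) h n⟩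

theorem IsSetSpace.continuous_nthIndicator {Z : Type*} [TopologicalSpace Z] {σ : Z → Set ℕ}
    (hσ : IsSetSpace σ) (n m : ℕ) : Continuous (nthIndicator σ n m) := by
  classical
  refine continuous_iff_continuousAt.2 fun z => ?_
  refine (continuousAt_const (y := nthIndicator σ n m z)).congr ?_
  filter_upwards [(hσ.hasBasis z).mem_of_mem (i := m + 1) trivial] with w hw
  have h1 : Nat.count (· ∈ σ w) m = Nat.count (· ∈ σ z) m := by
    simp only [Nat.count_eq_card_filter_range]
    congr 1
    refine Finset.filter_congr fun l hl => hw l ?_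
    have := Finset.mem_range.1 hl
    omega
  simp only [nthIndicator, h1, hw m (Nat.lt_succ_self m)]

/-- Evaluating at the finite set `{0, …, n - 1, m}` separates the two functions. -/
theorem nthIndicator_ne {Z : Type*} {σ : Z → Set ℕ} (hfin : ∀ s : Finset ℕ, ∃ z, σ z = s)
    {n m n' m' : ℕ} (hnm : n ≤ m) (hmm' : m < m') :
    nthIndicator σ n m ≠ nthIndicator σ n' m' := by
  classical
  obtain ⟨z, hz⟩ := hfin (insert m (Finset.range n))
  have hmem : ∀ l, l ∈ σ z ↔ l = m ∨ l < n := fun l => by simp [hz]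
  intro h
  have h1 : nthIndicator σ n m z = 1 := by
    refine if_pos ⟨(hmem m).2 (Or.inl rfl), ?_⟩
    rw [Nat.count_eq_card_filter_range]
    have : (Finset.range m).filter (· ∈ σ z) = Finset.range n := by
      ext l
      simp only [Finset.mem_filter, Finset.mem_range, hmem]
      omega
    rw [this, Finset.card_range]
  have h2 : nthIndicator σ n' m' z = 0 := by
    refine if_neg fun h' => ?_
    have := (hmem m').1 h'.1
    omega
  rw [h, h2] at h1
  exact zero_ne_one h1

/-- The `n`-th converging set consists of the functions `nthIndicator σ n m` with `m ≥ n`, which are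
pairwise distinct. Cofinite subsets containing all of these with `m > g n` force `enum (σ z)` to be
eventually bounded by `g` for each `z` with `σ z` infinite. -/
theorem not_isAlphaOne_of_unbounded {Z : Type*} [TopologicalSpace Z] {σ : Z → Set ℕ}
    (hσ : IsSetSpace σ) (hfin : ∀ s : Finset ℕ, ∃ z, σ z = s)
    (hunb : ∀ g : ℕ → ℕ, ∃ z, (σ z).Infinite ∧ {n | g n < enum (σ z) n}.Infinite) :
    ¬ IsAlphaOne {f : Z → ℝ // Continuous f} := by
  intro hα
  let f : ℕ → ℕ → {f : Z → ℝ // Continuous f} := fun n m =>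
    ⟨nthIndicator σ n m, hσ.continuous_nthIndicator n m⟩
  let y : {f : Z → ℝ // Continuous f} := ⟨fun _ => 0, continuous_const⟩
  have hne : ∀ {n m n' m'}, n ≤ m → m < m' → f n m ≠ f n' m' := fun h1 h2 h =>
    nthIndicator_ne hfin h1 h2 (congrArg Subtype.val h)
  have hinj : ∀ n, Function.Injective fun m => f n (n + m) := by
    intro n m m' h
    rcases lt_trichotomy m m' with hlt | heq | hlt
    · exact absurd h (hne (by omega) (by omega))
    · exact heq
    · exact absurd h.symm (hne (by omega) (by omega))
  have hA : ∀ n, SetConvergesTo (range fun m => f n (n + m)) y := by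
    intro n
    refine setConvergesTo_range (infinite_range_of_injective (hinj n)) ?_
    refine tendsto_subtype_rng.2 (tendsto_pi_nhds.2 fun z => ?_)
    refine tendsto_const_nhds.congr' ?_
    filter_upwards [eventually_gt_atTop (enum (σ z) n)] with m hm
    exact (nthIndicator_eq_zero (by omega)).symm
  obtain ⟨B, hB, hconv⟩ := hα y _ hA
  have hg : ∀ n, ∃ g, ∀ m ≥ n, g < m → f n m ∈ B n := by
    intro n
    have hfinite : {m | f n (n + m) ∉ B n}.Finite :=
      Finite.of_finite_image ((hB n).2.subset (by rintro _ ⟨m, hm, rfl⟩; exact ⟨⟨m, rfl⟩, hm⟩))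
        (hinj n).injOn
    obtain ⟨M, hM⟩ := hfinite.bddAbove
    refine ⟨n + M, fun m hm hlt => ?_⟩
    by_contra hcon
    have := hM (show m - n ∈ {m | f n (n + m) ∉ B n} by
      rw [mem_ofPred_eq, Nat.add_sub_cancel' hm]; exact hcon)
    omega
  choose g hg using hg
  obtain ⟨z, hz, hzg⟩ := hunb g
  have hU : {u : {f : Z → ℝ // Continuous f} | u.1 z < 1} ∈ 𝓝 y :=
    (isOpen_lt ((continuous_apply z).comp continuous_subtype_val) continuous_const).mem_nhds
      (show (0 : ℝ) < 1 from zero_lt_one)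
  have hfinite := (setConvergesTo_iff.1 hconv).2.2 _ hU
  refine hzg (Finite.of_finite_image (f := fun n => f n (enum (σ z) n)) (hfinite.subset ?_) ?_)
  · rintro _ ⟨n, hn, rfl⟩
    refine ⟨mem_iUnion.2 ⟨n, hg n _ (enum_strictMono hz).le_apply hn⟩, ?_⟩
    exact (nthIndicator_enum hz n).not_lt
  · intro n _ n' _ h
    rcases lt_trichotomy n n' with hlt | heq | hlt
    · exact absurd h (hne (enum_strictMono hz).le_apply (enum_strictMono hz hlt))
    · exact heq
    · exact absurd h.symm (hne (enum_strictMono hz).le_apply (enum_strictMono hz hlt))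

/-! ### Realisation on the real line -/

/-- Every family of sets of natural numbers is realised by a set of reals, inside the Cantor
set. -/
theorem exists_real_isSetSpace (S : Set (Set ℕ)) :
    ∃ (X : Set ℝ) (σ : X → Set ℕ), IsSetSpace σ ∧ range σ = S := by
  let X : Set ℝ := {r | ∃ h : r ∈ cantorSet, {k | cantorSetHomeomorphNatToBool ⟨r, h⟩ k} ∈ S}
  let φ : X → ℕ → Bool := fun r => cantorSetHomeomorphNatToBool ⟨r.1, r.2.choose⟩
  have hφ : IsEmbedding φ := cantorSetHomeomorphNatToBool.isEmbedding.comp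
    (IsEmbedding.inclusion (fun r (hr : r ∈ X) => hr.choose))
  refine ⟨X, fun r => {k | φ r k}, ⟨fun r r' h => hφ.injective (funext fun k => ?_), fun r => ?_⟩,
    ?_⟩
  · have := Set.ext_iff.1 h k
    exact Bool.eq_iff_iff.2 this
  · have hb : (𝓝 (φ r)).HasBasis (fun _ => True) fun N => PiNat.cylinder (φ r) N := by
      refine ⟨fun t => ?_⟩
      rw [(PiNat.isTopologicalBasis_cylinders fun _ : ℕ => Bool).mem_nhds_iff]
      constructor
      · rintro ⟨_, ⟨b, n, rfl⟩, hmem, hsub⟩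
        exact ⟨n, trivial, (PiNat.mem_cylinder_iff_eq.1 hmem).trans_subset hsub⟩
      · rintro ⟨n, -, hsub⟩
        exact ⟨_, ⟨φ r, n, rfl⟩, PiNat.self_mem_cylinder _ _, hsub⟩
    rw [hφ.nhds_eq_comap]
    convert hb.comap φ using 2 with N
    ext w
    exact forall₂_congr fun k _ => Bool.eq_iff_iff.symm
  · ext s
    constructor
    · rintro ⟨r, rfl⟩
      exact r.2.choose_spec
    · intro hs
      classical
      let b : ℕ → Bool := fun k => decide (k ∈ s)
      have hb : {k | b k} = s := by ext k; simp [b]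
      refine ⟨⟨(cantorSetHomeomorphNatToBool.symm b).1,
        (cantorSetHomeomorphNatToBool.symm b).2, by simpa [hb] using hs⟩, ?_⟩
      simpa [φ] using hb

end UnboundedTower

theorem mainTheorem7
    (h : ∃ (κ : Cardinal.{0}) (T : Set (Set ℕ)),
      UnboundedTower.IsTower κ T ∧ UnboundedTower.IsUnbounded T) :
    ∃ X : Set ℝ, UnboundedTower.IsAlphaTwo (UnboundedTower.PointwiseC X) ∧
      ¬ UnboundedTower.IsAlphaOne (UnboundedTower.PointwiseC X) := by
  obtain ⟨κ, T, hT, hU⟩ := h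
  obtain ⟨ι, _, x, hbdd, hinf, hdec, hunb⟩ := UnboundedTower.exists_short_unbounded_tower hT hU
  obtain ⟨X, σ, hσ, hrange⟩ :=
    UnboundedTower.exists_real_isSetSpace ({s | s.Finite} ∪ Set.range x)
  have hfin : ∀ s : Finset ℕ, ∃ z, σ z = s := fun s =>
    hrange.ge (Or.inl s.finite_toSet)
  have hx : ∀ i, ∃ z, σ z = x i := fun i => hrange.ge (Or.inr ⟨i, rfl⟩)
  refine ⟨X, UnboundedTower.isAlphaTwo_of_selection fun U hUo hev =>
    UnboundedTower.exists_selection hσ hbdd hinf hdec hunb hfin hx (fun z => ?_) hUo hev,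
    UnboundedTower.not_isAlphaOne_of_unbounded hσ hfin fun g => ?_⟩
  · rcases hrange.le ⟨z, rfl⟩ with hz | ⟨i, hi⟩
    · exact Or.inl hz
    · exact Or.inr ⟨i, hi.symm⟩
  · obtain ⟨i, hi⟩ : ∃ i, ¬ UnboundedTower.enum (x i) ≤ᶠ[Filter.atTop] g := by
      by_contra hcon
      push Not at hcon
      exact hunb ⟨g, hcon⟩
    obtain ⟨z, hz⟩ := hx i
    exact ⟨z, hz ▸ hinf i, hz ▸ UnboundedTower.not_eventually_le_iff.1 hi⟩
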